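/- Let $0<p\le 1$, $0\le q\le 1$, $0\le r\le 1$. In the three-interactions random graph model every vertex, edge and triangle has a weight, the number of interactions in which it has taken part. At time $n=0$ the graph is one triangle; this triangle, its three edges and its three vertices have weight $1$. At each step $n=1,2,\dots$ three vertices interact: all missing edges between them are drawn, and the weights of the triangle they form, of its three edges and of its three vertices are increased by $1$ (an object that has not interacted before has weight $0$ before its first interaction). Conditionally on the past, the three vertices are chosen as follows. With probability $p$ a new vertex is added, and it interacts with two old vertices; these are, with probability $r$, the end points of an existing edge chosen with probability proportional to its weight and, with probability $1-r$, two distinct old vertices chosen uniformly. With probability $1-p$ no vertex is added, and three old vertices interact; these are, with probability $q$, the vertices of an existing triangle chosen with probability proportional to its weight and, with probability $1-q$, three distinct old vertices chosen uniformly. Let $E(n,v)$ be the number of edges of weight $v$ after $n$ steps, and let $a=\tfrac13pr+(1-p)q$. Assume that $r>0$ or $(1-p)q>0$. Then there are positive numbers $e_1,e_2,\dots$ with $$e_1=\frac{p(3-r)+3(1-p)(1-q)}{(a+1)p},\qquad e_v=\frac{(v-1)a}{va+1}\,e_{v-1}\quad(v>1),$$ such that for every fixed $v\ge 1$ $$\frac{E(n,v)}{np}\to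 e_v\quad\text{almost surely as } n\to\infty .$$ -/

import Mathlib

open Filter Topology MeasureTheory

namespace ThreeInteractions

/-- A finite weighted graph. Its vertices are `0, …, numVertices - 1`, an edge is the two-element
set of its end points, and `weight c` is the weight of the clique with vertex set `c`
(vertices, edges and triangles are cliques with one, two and three vertices). -/
@[ext]
structure WeightedGraph where
  numVertices : ℕ
  edges : Finset (Finset ℕ)
  weight : Finset ℕ →₀ ℕ

instance : MeasurableSpace WeightedGraph := ⊤

namespace WeightedGraph

/-- The vertex set. -/
def vertices (G : WeightedGraph) : Finset ℕ := Finset.range G.numVertices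

/-- The triangles of the graph: the three-element vertex sets all of whose pairs are edges. -/
def triangles (G : WeightedGraph) : Finset (Finset ℕ) :=
  (G.vertices.powersetCard 3).filter fun t => t.powersetCard 2 ⊆ G.edges

/-- The number of edges of weight `v`. -/
def edgeCount (G : WeightedGraph) (v : ℕ) : ℕ :=
  (G.edges.filter fun e => G.weight e = v).card

/-- The interaction of the vertices in `T`: all missing edges between them are drawn, and the
weights of all the cliques formed by vertices of `T` are increased by one. -/
noncomputable def interact (G : WeightedGraph) (T : Finset ℕ) : WeightedGraph where
  numVertices := G.numVertices
  edges := G.edges ∪ T.powersetCard 2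
  weight := G.weight + ∑ c ∈ T.powerset.erase ∅, Finsupp.single c 1

/-- A new isolated vertex, with label `numVertices`, is added. -/
def addVertex (G : WeightedGraph) : WeightedGraph :=
  { G with numVertices := G.numVertices + 1 }

/-- A new vertex is added, and it interacts with the old vertices in `e`. -/
noncomputable def addVertexInteract (G : WeightedGraph) (e : Finset ℕ) : WeightedGraph :=
  G.addVertex.interact (insert G.numVertices e)

/-- The starting graph: one triangle, where the triangle, its edges and its vertices have
weight one. -/
noncomputable def initial : WeightedGraph where
  numVertices := 3
  edges := (Finset.range 3).powersetCard 2
  weight := ∑ c ∈ (Finset.range 3).powerset.erase ∅, Finsupp.single c 1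

end WeightedGraph

open Classical in
/-- The probability that `x` is drawn, if an element of `S` is drawn with probabilities
proportional to the weights `w`. -/
noncomputable def drawProb {α : Type*} (S : Finset α) (w : α → ℕ) (x : α) : ℝ :=
  if x ∈ S then (w x : ℝ) / ∑ y ∈ S, (w y : ℝ) else 0

/-- The probability that `e` is the pair of old vertices that interacts with a new vertex: with
probability `r` an edge is drawn according to the weights, with probability `1 - r` two vertices
are drawn uniformly. -/
noncomputable def pairProb (r : ℝ) (G : WeightedGraph) (e : Finset ℕ) : ℝ :=
  r * drawProb G.edges G.weight e
    + (1 - r) * drawProb (G.vertices.powersetCard 2) (fun _ => 1) e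

/-- The probability that `t` is the triple of interacting old vertices, if there is no new vertex:
with probability `q` a triangle is drawn according to the weights, with probability `1 - q` three
vertices are drawn uniformly. -/
noncomputable def tripleProb (q : ℝ) (G : WeightedGraph) (t : Finset ℕ) : ℝ :=
  q * drawProb G.triangles G.weight t
    + (1 - q) * drawProb (G.vertices.powersetCard 3) (fun _ => 1) t

open Classical in
/-- The probability that one step of the evolution leads from `G` to `H`: with probability `p` a
new vertex is added and interacts with two old vertices, with probability `1 - p` three old
vertices interact. -/
noncomputable def stepProb (p q r : ℝ) (G H : WeightedGraph) : ℝ :=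
  p * (∑ e ∈ G.vertices.powersetCard 2,
      if G.addVertexInteract e = H then pairProb r G e else 0)
    + (1 - p) * (∑ t ∈ G.vertices.powersetCard 3,
      if G.interact t = H then tripleProb q G t else 0)

/-- `X 0, X 1, …` is the three-interactions random graph process with parameters `p, q, r`: it
starts from one triangle, and given the evolution up to step `n`, the next graph is chosen with
the probabilities `stepProb p q r (X n)`. -/
structure IsThreeInteractionsProcess {Ω : Type*} [MeasurableSpace Ω] (μ : Measure Ω)
    (p q r : ℝ) (X : ℕ → Ω → WeightedGraph) : Prop where
  measurable : ∀ n, Measurable (X n)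
  initial : ∀ᵐ ω ∂μ, X 0 ω = WeightedGraph.initial
  step : ∀ (n : ℕ) (g : ℕ → WeightedGraph) (H : WeightedGraph),
    μ.real {ω | (∀ i ≤ n, X i ω = g i) ∧ X (n + 1) ω = H}
      = μ.real {ω | ∀ i ≤ n, X i ω = g i} * stepProb p q r (g n) H

/-- The parameter `a = pr/3 + (1 - p)q`. -/
noncomputable def paramA (p q r : ℝ) : ℝ := 1 / 3 * p * r + (1 - p) * q

end ThreeInteractions

/-! ### Deterministic recursions and averages. -/

namespace ThreeInteractions

/-! Count pairs of vertices instead of edges, a pair that is not an edge having weight 0. After `n`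
steps there have been `n + 1` interacting triples, the starting one included. Double counting over
them gives total pair weight `3(n+1)` and total triangle weight `n+1`, and shows that the triangles
on a pair `e` have total weight `weight e`. Hence, given the past, a pair of weight `w` takes part
in the next interaction with probability `a w/(n+1) + γ/(N choose 2)`, where `N` is the number of
vertices and `γ = p(1-r) + 3(1-p)(1-q)`.

So the number `P_v` of pairs of weight `v ≥ 1` has drift `2p[v=1] + a((v-1)P_{v-1} - vP_v)/(n+1) +
γ(P_{v-1} - P_v)/(N choose 2)` (`stepMean_pairCount`). Since `N ~ pn` while there are only `O(n)`
edges, the last term tends to `γ` for `v = 1` and to `0` for `v > 1`.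

The deviations from the drift are bounded martingale differences; being orthogonal, they average to
`0` almost surely (`ae_tendsto_sum_div_of_orthogonal`). What remains is deterministic: a recursion
with inhomogeneity tending to `b` and damping `va/(n+1)` forces `P_v/n → b/(1+va)`
(`tendsto_div_of_linear_recursion`). Induction on `v` gives the limits `p e_v`. -/

theorem tendsto_div_atTop_zero_of_abs_succ_le {D η : ℕ → ℝ} {n₀ : ℕ}
    (hD : ∀ n ≥ n₀, |D (n + 1)| ≤ |D n| + |η n|) (hη : Tendsto η atTop (𝓝 0)) :
    Tendsto (fun n : ℕ => D n / n) atTop (𝓝 0) := by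
  have hbound : ∀ n ≥ n₀, |D n| ≤ |D n₀| + ∑ k ∈ Finset.range n, |η k| := by
    intro n hn
    induction n, hn using Nat.le_induction with
    | base =>
      have : 0 ≤ ∑ k ∈ Finset.range n₀, |η k| := Finset.sum_nonneg fun _ _ => abs_nonneg _
      linarith
    | succ n hn ih =>
      rw [Finset.sum_range_succ]
      linarith [hD n hn]
  have hces : Tendsto (fun n : ℕ => |D n₀| * (n : ℝ)⁻¹ + (n : ℝ)⁻¹ * ∑ k ∈ Finset.range n, |η k|)
      atTop (𝓝 0) := by
    have h1 : Tendsto (fun n => |η n|) atTop (𝓝 0) := by simpa using hη.abs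
    have h2 := (tendsto_inv_atTop_nhds_zero_nat (𝕜 := ℝ)).const_mul |D n₀|
    simpa using h2.add h1.cesaro
  refine squeeze_zero_norm' ?_ hces
  filter_upwards [eventually_ge_atTop n₀] with n hn
  rw [Real.norm_eq_abs, abs_div, Nat.abs_cast, div_eq_mul_inv, mul_comm (n : ℝ)⁻¹, ← add_mul]
  exact mul_le_mul_of_nonneg_right (hbound n hn) (by positivity)

/-- The averages `y n / n` of a solution of a perturbed linear recursion converge. -/
theorem tendsto_div_of_linear_recursion {y b m : ℕ → ℝ} {c L : ℝ} (hc : 0 ≤ c)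
    (hb : Tendsto b atTop (𝓝 (L * (1 + c))))
    (hm : Tendsto (fun n : ℕ => (∑ k ∈ Finset.range n, m k) / n) atTop (𝓝 0))
    (h : ∀ n : ℕ, y (n + 1) - y n = b n - c * y n / (n + 1) + m n) :
    Tendsto (fun n : ℕ => y n / n) atTop (𝓝 L) := by
  set S : ℕ → ℝ := fun n => ∑ k ∈ Finset.range n, m k with hS
  -- Without the noise `S` and the expected growth `L n`, the remainder is multiplied by `1 -
  -- c/(n+1)` and receives an error `η n → 0`. From `n ≥ c` on the factor lies in `[0, 1]`.
  set D : ℕ → ℝ := fun n => y n - S n - L * n with hDdef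
  set η : ℕ → ℝ := fun n => (b n - L * (1 + c)) - c * (S n / (n + 1)) + c * L * (1 / ((n : ℝ) + 1))
    with hηdef
  have hrec : ∀ n, D (n + 1) = D n * (1 - c / (n + 1)) + η n := by
    intro n
    have h1 := h n
    have hne : (n : ℝ) + 1 ≠ 0 := by positivity
    have hS1 : S (n + 1) = S n + m n := Finset.sum_range_succ _ _
    simp only [hDdef, hηdef, hS1]
    have : y (n + 1) = y n + (b n - c * y n / (n + 1) + m n) := by linarith
    rw [this]
    push_cast
    field_simp
    ring
  have hη : Tendsto η atTop (𝓝 0) := by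
    have h1 : Tendsto (fun n => b n - L * (1 + c)) atTop (𝓝 0) := by
      simpa using hb.sub_const (L * (1 + c))
    have h2 : Tendsto (fun n : ℕ => S n / ((n : ℝ) + 1)) atTop (𝓝 0) := by
      have := hm.mul (tendsto_natCast_div_add_atTop (1 : ℝ))
      rw [zero_mul] at this
      refine this.congr' ?_
      filter_upwards [eventually_gt_atTop 0] with n hn
      have : (n : ℝ) ≠ 0 := by positivity
      have : (n : ℝ) + 1 ≠ 0 := by positivity
      simp only [hS]
      field_simp
    have h3 := tendsto_one_div_add_atTop_nhds_zero_nat (𝕜 := ℝ)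
    simpa [hηdef] using (h1.sub (h2.const_mul c)).add (h3.const_mul (c * L))
  have hD : Tendsto (fun n : ℕ => D n / n) atTop (𝓝 0) := by
    refine tendsto_div_atTop_zero_of_abs_succ_le (n₀ := ⌈c⌉₊) (fun n hn => ?_) hη
    rw [hrec]
    refine (abs_add_le _ _).trans (add_le_add ?_ le_rfl)
    rw [abs_mul]
    refine mul_le_of_le_one_right (abs_nonneg _) ?_
    have hcn : c ≤ n + 1 := by
      have := Nat.ceil_le.mp hn
      linarith
    have h1 : c / ((n : ℝ) + 1) ≤ 1 := (div_le_one (by positivity)).2 hcn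
    have h2 : 0 ≤ c / ((n : ℝ) + 1) := by positivity
    rw [abs_le]
    constructor <;> linarith
  have := (hD.add hm).add_const L
  simp only [zero_add] at this
  refine this.congr' ?_
  filter_upwards [eventually_gt_atTop 0] with n hn
  have : (n : ℝ) ≠ 0 := by positivity
  simp only [hDdef, hS]
  field_simp
  ring

/-- Partial sums with bounded increments are `o(n)` as soon as they are along the squares. -/
theorem tendsto_sum_div_of_tendsto_sq {x : ℕ → ℝ} {C : ℝ} (hx : ∀ n, |x n| ≤ C)
    (h : Tendsto (fun k : ℕ => (∑ i ∈ Finset.range (k ^ 2), x i) / (k : ℝ) ^ 2) atTop (𝓝 0)) :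
    Tendsto (fun n : ℕ => (∑ i ∈ Finset.range n, x i) / n) atTop (𝓝 0) := by
  have hC : 0 ≤ C := (abs_nonneg _).trans (hx 0)
  have hsqrt : Tendsto Nat.sqrt atTop atTop :=
    tendsto_atTop_mono' (f₁ := fun n => Nat.sqrt n) _ (Eventually.of_forall fun n => le_rfl)
      (tendsto_atTop_atTop.2 fun b => ⟨b ^ 2, fun n hn => Nat.le_sqrt'.2 hn⟩)
  have hlim : Tendsto (fun k : ℕ => |(∑ i ∈ Finset.range (k ^ 2), x i) / (k : ℝ) ^ 2|
      + 2 * C * (k : ℝ)⁻¹) atTop (𝓝 0) := by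
    simpa using h.abs.add ((tendsto_inv_atTop_nhds_zero_nat (𝕜 := ℝ)).const_mul (2 * C))
  refine squeeze_zero_norm' ?_ (hlim.comp hsqrt)
  filter_upwards [eventually_gt_atTop 0] with n hn
  simp only [Function.comp]
  set k := Nat.sqrt n with hk
  have hk0 : 0 < k := Nat.sqrt_pos.2 hn
  have hkn : k ^ 2 ≤ n := Nat.sqrt_le' n
  -- At most `2k` terms lie beyond the last square; they contribute at most `2kC`, which is
  -- negligible against `k ^ 2`.
  have hnk : n ≤ k ^ 2 + 2 * k := by
    have := Nat.sqrt_le_add n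
    nlinarith [this]
  have hkR : (0 : ℝ) < k := by exact_mod_cast hk0
  have hknR : (k : ℝ) ^ 2 ≤ n := by exact_mod_cast hkn
  have hdiff : |∑ i ∈ Finset.Ico (k ^ 2) n, x i| ≤ 2 * k * C := by
    calc |∑ i ∈ Finset.Ico (k ^ 2) n, x i| ≤ ∑ i ∈ Finset.Ico (k ^ 2) n, |x i| :=
          Finset.abs_sum_le_sum_abs _ _
      _ ≤ ∑ i ∈ Finset.Ico (k ^ 2) n, C := Finset.sum_le_sum fun i _ => hx i
      _ = ((n - k ^ 2 : ℕ) : ℝ) * C := by simp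
      _ ≤ 2 * k * C := by
          gcongr
          have : n - k ^ 2 ≤ 2 * k := by omega
          exact_mod_cast this
  rw [← Finset.sum_range_add_sum_Ico _ hkn, Real.norm_eq_abs, abs_div, Nat.abs_cast, abs_div,
    abs_of_pos (pow_pos hkR 2)]
  calc _ ≤ |∑ i ∈ Finset.range (k ^ 2), x i + ∑ i ∈ Finset.Ico (k ^ 2) n, x i| / (k : ℝ) ^ 2 := by
        gcongr
    _ ≤ (|∑ i ∈ Finset.range (k ^ 2), x i| + 2 * k * C) / (k : ℝ) ^ 2 := by
        gcongr
        exact (abs_add_le _ _).trans (by gcongr)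
    _ = _ := by field_simp

/-! ### Strong law for bounded orthogonal variables. -/

section StrongLaw

variable {Ω : Type*} [MeasurableSpace Ω] {μ : Measure Ω} [IsProbabilityMeasure μ]

theorem integrable_mul_of_ae_bound {f g : Ω → ℝ} {C : ℝ} (hf : Measurable f) (hg : Measurable g)
    (hfC : ∀ᵐ ω ∂μ, |f ω| ≤ C) (hgC : ∀ᵐ ω ∂μ, |g ω| ≤ C) :
    Integrable (fun ω => f ω * g ω) μ := by
  refine Integrable.of_bound (hf.mul hg).aestronglyMeasurable (C * C) ?_
  filter_upwards [hfC, hgC] with ω h1 h2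
  rw [Real.norm_eq_abs, abs_mul]
  exact mul_le_mul h1 h2 (abs_nonneg _) ((abs_nonneg _).trans h1)

theorem integral_sq_sum_le_of_orthogonal {ξ : ℕ → Ω → ℝ} {C : ℝ} (hmeas : ∀ n, Measurable (ξ n))
    (hbound : ∀ n, ∀ᵐ ω ∂μ, |ξ n ω| ≤ C)
    (horth : ∀ i j, i < j → ∫ ω, ξ i ω * ξ j ω ∂μ = 0) (n : ℕ) :
    Integrable (fun ω => (∑ i ∈ Finset.range n, ξ i ω) ^ 2) μ ∧
      ∫ ω, (∑ i ∈ Finset.range n, ξ i ω) ^ 2 ∂μ ≤ n * C ^ 2 := by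
  have hint : ∀ i j, Integrable (fun ω => ξ i ω * ξ j ω) μ := fun i j =>
    integrable_mul_of_ae_bound (hmeas i) (hmeas j) (hbound i) (hbound j)
  have hexp : ∀ ω, (∑ i ∈ Finset.range n, ξ i ω) ^ 2
      = ∑ i ∈ Finset.range n, ∑ j ∈ Finset.range n, ξ i ω * ξ j ω := fun ω => by
    rw [sq, Finset.sum_mul_sum]
  simp only [hexp]
  refine ⟨integrable_finsetSum _ fun i _ => integrable_finsetSum _ fun j _ => hint i j, ?_⟩
  rw [integral_finsetSum _ fun i _ => integrable_finsetSum _ fun j _ => hint i j]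
  calc _ = ∑ i ∈ Finset.range n, ∫ ω, ξ i ω * ξ i ω ∂μ := by
        refine Finset.sum_congr rfl fun i hi => ?_
        rw [integral_finsetSum _ fun j _ => hint i j]
        refine Finset.sum_eq_single_of_mem i hi fun j _ hji => ?_
        rcases lt_or_gt_of_ne hji with hlt | hlt
        · simpa only [mul_comm] using horth j i hlt
        · exact horth i j hlt
    _ ≤ ∑ i ∈ Finset.range n, C ^ 2 := by
        refine Finset.sum_le_sum fun i _ => ?_
        have : ∫ ω, ξ i ω * ξ i ω ∂μ ≤ ∫ _, C ^ 2 ∂μ := by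
          refine integral_mono_ae (hint i i) (integrable_const _) ?_
          filter_upwards [hbound i] with ω hω
          rw [← sq, ← sq_abs]
          exact pow_le_pow_left₀ (abs_nonneg _) hω 2
        simpa using this
    _ = n * C ^ 2 := by simp

/-- Strong law of large numbers for uniformly bounded, pairwise orthogonal random variables. -/
theorem ae_tendsto_sum_div_of_orthogonal {ξ : ℕ → Ω → ℝ} {C : ℝ} (hmeas : ∀ n, Measurable (ξ n))
    (hbound : ∀ n, ∀ᵐ ω ∂μ, |ξ n ω| ≤ C)
    (horth : ∀ i j, i < j → ∫ ω, ξ i ω * ξ j ω ∂μ = 0) :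
    ∀ᵐ ω ∂μ, Tendsto (fun n : ℕ => (∑ i ∈ Finset.range n, ξ i ω) / n) atTop (𝓝 0) := by
  -- The squared average over `k ^ 2` terms has mean at most `C ^ 2 / k ^ 2`. This is summable, so
  -- `∑ Q k` is almost surely finite and `Q k → 0`.
  set Q : ℕ → Ω → ℝ := fun k ω => ((∑ i ∈ Finset.range (k ^ 2), ξ i ω) / (k : ℝ) ^ 2) ^ 2 with hQ
  have hQmeas : ∀ k, Measurable (Q k) := fun k =>
    ((Finset.measurable_fun_sum _ fun i _ => hmeas i).div_const _).pow_const 2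
  have hle : ∀ k : ℕ, ∫⁻ ω, ENNReal.ofReal (Q k ω) ∂μ
      ≤ ENNReal.ofReal (C ^ 2 * (1 / (k : ℝ) ^ 2)) := by
    intro k
    obtain ⟨hi, hl⟩ := integral_sq_sum_le_of_orthogonal hmeas hbound horth (k ^ 2)
    have hQi : Integrable (Q k) μ := by
      simp only [hQ, div_pow]
      exact hi.div_const _
    rw [← ofReal_integral_eq_lintegral_ofReal hQi (Eventually.of_forall fun ω => sq_nonneg _)]
    refine ENNReal.ofReal_le_ofReal ?_
    simp only [hQ, div_pow]
    rw [integral_div]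
    rcases Nat.eq_zero_or_pos k with rfl | hk
    · simp
    · have hk' : (0 : ℝ) < k := by exact_mod_cast hk
      rw [div_le_iff₀ (by positivity)]
      refine hl.trans (le_of_eq ?_)
      push_cast
      field_simp
  have hsum : ∫⁻ ω, ∑' k, ENNReal.ofReal (Q k ω) ∂μ ≠ ⊤ := by
    rw [lintegral_tsum fun k => ((hQmeas k).ennreal_ofReal).aemeasurable]
    refine ne_top_of_le_ne_top ?_ (ENNReal.tsum_le_tsum hle)
    exact ((Real.summable_one_div_nat_pow.2 one_lt_two).mul_left (C ^ 2)).tsum_ofReal_ne_top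
  have hfin : ∀ᵐ ω ∂μ, ∑' k, ENNReal.ofReal (Q k ω) < ⊤ :=
    ae_lt_top (Measurable.tsum fun k => (hQmeas k).ennreal_ofReal) hsum
  filter_upwards [hfin, ae_all_iff.2 hbound] with ω hω hb
  refine tendsto_sum_div_of_tendsto_sq hb ?_
  have h1 := ENNReal.tendsto_atTop_zero_of_tsum_ne_top hω.ne
  have h2 : Tendsto (fun k => Q k ω) atTop (𝓝 0) := by
    have := (ENNReal.tendsto_toReal ENNReal.zero_ne_top).comp h1
    simpa [Function.comp_def, ENNReal.toReal_ofReal, hQ, sq_nonneg] using this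
  have h3 := h2.sqrt
  simp only [hQ, Real.sqrt_sq_eq_abs, Real.sqrt_zero] at h3
  exact (tendsto_zero_iff_abs_tendsto_zero _).2 h3

end StrongLaw

/-! ### Histories of interactions and double counting. -/

namespace WeightedGraph

/-- `G` arises from `n + 1` interactions of triples of its vertices. -/
def HasHistory (n : ℕ) (G : WeightedGraph) : Prop :=
  3 ≤ G.numVertices ∧ ∃ T : ℕ → Finset ℕ,
    (∀ i ∈ Finset.range (n + 1), T i ∈ G.vertices.powersetCard 3) ∧
    G.edges = (Finset.range (n + 1)).biUnion (fun i => (T i).powersetCard 2) ∧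
    ∀ c, c ≠ ∅ → G.weight c = ∑ i ∈ Finset.range (n + 1), if c ⊆ T i then 1 else 0

/-- The empty set is excluded because it lies in every `T` but never gains weight. -/
theorem sum_single_apply (T c : Finset ℕ) (hc : c ≠ ∅) :
    (∑ d ∈ T.powerset.erase ∅, Finsupp.single d 1) c = if c ⊆ T then 1 else 0 := by
  rw [Finsupp.finsetSum_apply]
  simp only [Finsupp.single_apply]
  rw [Finset.sum_ite_eq']
  simp [hc]

theorem interact_weight (G : WeightedGraph) (T c : Finset ℕ) (hc : c ≠ ∅) :
    (G.interact T).weight c = G.weight c + if c ⊆ T then 1 else 0 := by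
  simp only [interact, Finsupp.add_apply, sum_single_apply T c hc]

theorem hasHistory_initial : HasHistory 0 initial := by
  refine ⟨le_rfl, fun _ => Finset.range 3, ?_, ?_, ?_⟩
  · intro i _
    simp [initial, vertices]
  · simp [initial]
  · intro c hc
    simp only [initial, sum_single_apply _ c hc]
    simp

theorem HasHistory.interact {n : ℕ} {G : WeightedGraph} (h : G.HasHistory n) {t : Finset ℕ}
    (ht : t ∈ G.vertices.powersetCard 3) : (G.interact t).HasHistory (n + 1) := by
  obtain ⟨h3, T, hT, hE, hw⟩ := h
  obtain ⟨T', hnew, hold⟩ : ∃ T' : ℕ → Finset ℕ,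
      T' (n + 1) = t ∧ ∀ i ∈ Finset.range (n + 1), T' i = T i :=
    ⟨Function.update T (n + 1) t, by simp, fun i hi =>
      Function.update_of_ne (Finset.mem_range.1 hi).ne _ _⟩
  refine ⟨h3, T', ?_, ?_, ?_⟩
  · intro i hi
    rcases eq_or_ne i (n + 1) with rfl | hne
    · rw [hnew]
      exact ht
    · have hi' : i ∈ Finset.range (n + 1) := by simp at hi ⊢; omega
      rw [hold i hi']
      exact hT i hi'
  · rw [Finset.range_add_one (n := n + 1), Finset.biUnion_insert, hnew, Finset.union_comm,
      Finset.biUnion_congr rfl fun i hi => by rw [hold i hi], ← hE]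
    rfl
  · intro c hc
    rw [interact_weight _ _ _ hc, Finset.sum_range_succ, hnew, hw c hc]
    congr 1
    exact Finset.sum_congr rfl fun i hi => by rw [hold i hi]

theorem vertices_addVertex (G : WeightedGraph) :
    G.addVertex.vertices = insert G.numVertices G.vertices := by
  simp [vertices, addVertex, Finset.range_add_one]

theorem numVertices_notMem (G : WeightedGraph) : G.numVertices ∉ G.vertices := by
  simp [vertices]

theorem HasHistory.addVertex {n : ℕ} {G : WeightedGraph} (h : G.HasHistory n) :
    G.addVertex.HasHistory n := by
  obtain ⟨h3, T, hT, hE, hw⟩ := h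
  refine ⟨h3.trans (Nat.le_succ _), T, fun i hi => ?_, hE, hw⟩
  rw [vertices_addVertex]
  exact Finset.powersetCard_mono (Finset.subset_insert _ _) (hT i hi)

theorem insert_mem_powersetCard (G : WeightedGraph) {e : Finset ℕ}
    (he : e ∈ G.vertices.powersetCard 2) :
    insert G.numVertices e ∈ G.addVertex.vertices.powersetCard 3 := by
  rw [Finset.mem_powersetCard] at he ⊢
  rw [vertices_addVertex]
  refine ⟨Finset.insert_subset_insert _ he.1, ?_⟩
  rw [Finset.card_insert_of_notMem fun h => G.numVertices_notMem (he.1 h), he.2]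

theorem HasHistory.addVertexInteract {n : ℕ} {G : WeightedGraph} (h : G.HasHistory n)
    {e : Finset ℕ} (he : e ∈ G.vertices.powersetCard 2) :
    (G.addVertexInteract e).HasHistory (n + 1) :=
  h.addVertex.interact (G.insert_mem_powersetCard he)

theorem ne_empty_of_mem_powersetCard {s e : Finset ℕ} {k : ℕ}
    (he : e ∈ s.powersetCard (k + 1)) : e ≠ ∅ := by
  rintro rfl
  simp at he

section History

variable {n : ℕ} {G : WeightedGraph} (h : G.HasHistory n)
include h

theorem HasHistory.weight_eq_zero {c : Finset ℕ} (hc : ¬ c ⊆ G.vertices) : G.weight c = 0 := by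
  obtain ⟨h3, T, hT, hE, hw⟩ := h
  have hc0 : c ≠ ∅ := by rintro rfl; simp at hc
  rw [hw c hc0]
  refine Finset.sum_eq_zero fun i hi => if_neg fun hsub => hc (hsub.trans ?_)
  exact (Finset.mem_powersetCard.1 (hT i hi)).1

theorem HasHistory.edges_subset : G.edges ⊆ G.vertices.powersetCard 2 := by
  obtain ⟨h3, T, hT, hE, hw⟩ := h
  rw [hE]
  exact Finset.biUnion_subset.2 fun i hi =>
    Finset.powersetCard_mono (Finset.mem_powersetCard.1 (hT i hi)).1

/-- An edge is drawn by the same interaction that first raises its weight. -/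
theorem HasHistory.mem_edges_iff {e : Finset ℕ} (he : e ∈ G.vertices.powersetCard 2) :
    e ∈ G.edges ↔ G.weight e ≠ 0 := by
  obtain ⟨h3, T, hT, hE, hw⟩ := h
  rw [hE, hw e (ne_empty_of_mem_powersetCard he)]
  simp [Finset.mem_powersetCard, (Finset.mem_powersetCard.1 he).2]

/-- Only this direction holds: a triangle whose edges stem from different interactions may have
weight 0. It suffices for replacing sums over triangles by sums over all triples. -/
theorem HasHistory.weight_eq_zero_of_notMem_triangles {t : Finset ℕ}
    (ht : t ∈ G.vertices.powersetCard 3) (htt : t ∉ G.triangles) : G.weight t = 0 := by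
  obtain ⟨h3, T, hT, hE, hw⟩ := h
  rw [hw t (ne_empty_of_mem_powersetCard ht)]
  refine Finset.sum_eq_zero fun i hi => if_neg fun hsub => htt ?_
  rw [triangles, Finset.mem_filter, hE]
  refine ⟨ht, (Finset.powersetCard_mono hsub).trans fun e he => ?_⟩
  exact Finset.mem_biUnion.2 ⟨i, hi, he⟩

/-- Each interacting triple contains exactly three pairs. -/
theorem HasHistory.sum_pairs_weight :
    ∑ e ∈ G.vertices.powersetCard 2, G.weight e = 3 * (n + 1) := by
  obtain ⟨h3, T, hT, hE, hw⟩ := h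
  rw [Finset.sum_congr rfl fun e he => hw e (ne_empty_of_mem_powersetCard he), Finset.sum_comm]
  have : ∀ i ∈ Finset.range (n + 1),
      (∑ e ∈ G.vertices.powersetCard 2, if e ⊆ T i then 1 else 0) = 3 := by
    intro i hi
    obtain ⟨hs, hc⟩ := Finset.mem_powersetCard.1 (hT i hi)
    rw [Finset.sum_boole]
    have : (G.vertices.powersetCard 2).filter (fun e => e ⊆ T i) = (T i).powersetCard 2 := by
      ext e
      simp only [Finset.mem_filter, Finset.mem_powersetCard]
      exact ⟨fun ⟨⟨_, h2⟩, h1⟩ => ⟨h1, h2⟩, fun ⟨h1, h2⟩ => ⟨⟨h1.trans hs, h2⟩, h1⟩⟩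
    rw [this, Finset.card_powersetCard, hc]
    rfl
  rw [Finset.sum_congr rfl this]
  simp [mul_comm]

/-- The triangles on a set `e` have total weight equal to the number of interactions
containing `e`. -/
theorem HasHistory.sum_triples_weight {e : Finset ℕ} :
    ∃ T : ℕ → Finset ℕ, (e ≠ ∅ → G.weight e = ∑ i ∈ Finset.range (n + 1), if e ⊆ T i then 1 else 0) ∧
    ∑ t ∈ (G.vertices.powersetCard 3).filter (fun t => e ⊆ t), G.weight t =
      ∑ i ∈ Finset.range (n + 1), if e ⊆ T i then 1 else 0 := by
  obtain ⟨h3, T, hT, hE, hw⟩ := h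
  refine ⟨T, hw e, ?_⟩
  rw [Finset.sum_congr rfl fun t ht =>
    hw t (ne_empty_of_mem_powersetCard (Finset.mem_filter.1 ht).1), Finset.sum_comm]
  refine Finset.sum_congr rfl fun i hi => ?_
  have hTi := Finset.mem_powersetCard.1 (hT i hi)
  -- A triple contained in a triple equals it, so each interaction is counted for one `t` only.
  have hiff : ∀ t ∈ (G.vertices.powersetCard 3).filter (fun t => e ⊆ t), (t ⊆ T i ↔ T i = t) := by
    intro t ht
    have htc := Finset.mem_powersetCard.1 (Finset.mem_filter.1 ht).1
    exact ⟨fun hs => (Finset.eq_of_subset_of_card_le hs (by omega)).symm, fun hs => hs ▸ subset_rfl⟩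
  rw [Finset.sum_congr rfl fun t ht => if_congr (hiff t ht) rfl rfl, Finset.sum_ite_eq]
  exact if_congr (by simp [hTi]) rfl rfl

theorem HasHistory.sum_triples_containing {e : Finset ℕ} (he : e ≠ ∅) :
    ∑ t ∈ (G.vertices.powersetCard 3).filter (fun t => e ⊆ t), G.weight t = G.weight e := by
  obtain ⟨T, h1, h2⟩ := h.sum_triples_weight (e := e)
  rw [h1 he, h2]

theorem HasHistory.sum_triples : ∑ t ∈ G.vertices.powersetCard 3, G.weight t = n + 1 := by
  obtain ⟨T, -, h2⟩ := h.sum_triples_weight (e := ∅)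
  simpa using h2

theorem HasHistory.card_edges_le : G.edges.card ≤ 3 * (n + 1) := by
  rw [← h.sum_pairs_weight, Finset.card_eq_sum_ones]
  refine (Finset.sum_le_sum fun e he => ?_).trans (Finset.sum_le_sum_of_subset h.edges_subset)
  exact Nat.one_le_iff_ne_zero.2 ((h.mem_edges_iff (h.edges_subset he)).1 he)

theorem HasHistory.sum_edges_weight : ∑ e ∈ G.edges, G.weight e = 3 * (n + 1) := by
  rw [← h.sum_pairs_weight]
  refine Finset.sum_subset h.edges_subset fun e he hne => ?_
  by_contra h0
  exact hne ((h.mem_edges_iff he).2 h0)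

theorem HasHistory.sum_triangles_weight : ∑ t ∈ G.triangles, G.weight t = n + 1 := by
  rw [← h.sum_triples]
  exact Finset.sum_subset (Finset.filter_subset _ _) fun t ht hne =>
    h.weight_eq_zero_of_notMem_triangles ht hne

end History

/-! ### Pair counts and their change in one interaction. -/

/-- The number of pairs of vertices of weight `v`; a pair that is not an edge has weight `0`. -/
def pairCount (G : WeightedGraph) (v : ℕ) : ℕ :=
  ((G.vertices.powersetCard 2).filter fun e => G.weight e = v).card

/-- Pairs are preferable because `pairCount 0` is the supply from which old vertices form edges of
weight 1. -/
theorem HasHistory.edgeCount_eq {n : ℕ} {G : WeightedGraph} (h : G.HasHistory n) {v : ℕ}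
    (hv : 1 ≤ v) : G.edgeCount v = G.pairCount v := by
  rw [edgeCount, pairCount]
  congr 1
  ext e
  simp only [Finset.mem_filter]
  constructor
  · exact fun ⟨h1, h2⟩ => ⟨h.edges_subset h1, h2⟩
  · exact fun ⟨h1, h2⟩ => ⟨(h.mem_edges_iff h1).2 (by omega), h2⟩

theorem HasHistory.pairCount_le {n : ℕ} {G : WeightedGraph} (h : G.HasHistory n) {v : ℕ}
    (hv : 1 ≤ v) : G.pairCount v ≤ 3 * (n + 1) := by
  rw [← h.edgeCount_eq hv]
  exact (Finset.card_filter_le _ _).trans h.card_edges_le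

theorem HasHistory.pairCount_zero {n : ℕ} {G : WeightedGraph} (h : G.HasHistory n) :
    G.pairCount 0 ≤ G.numVertices.choose 2 ∧
      G.numVertices.choose 2 ≤ G.pairCount 0 + 3 * (n + 1) := by
  have hcard : (G.vertices.powersetCard 2).card = G.numVertices.choose 2 := by
    simp [vertices]
  have hsplit := Finset.card_filter_add_card_filter_not (s := G.vertices.powersetCard 2)
    (fun e => G.weight e = 0)
  have : (G.vertices.powersetCard 2).filter (fun e => ¬ G.weight e = 0) ⊆ G.edges := by
    intro e he
    obtain ⟨h1, h2⟩ := Finset.mem_filter.1 he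
    exact (h.mem_edges_iff h1).2 h2
  have := (Finset.card_le_card this).trans h.card_edges_le
  rw [pairCount]
  omega

/-- The change of the number of pairs of weight `v`, if a pair of weight `w` interacts. -/
noncomputable def weightShift (v w : ℕ) : ℝ :=
  (if w + 1 = v then 1 else 0) - (if w = v then 1 else 0)

theorem abs_weightShift_le (v w : ℕ) : |weightShift v w| ≤ 1 := by
  unfold weightShift
  split_ifs <;> simp

theorem pairCount_eq_sum (G : WeightedGraph) (v : ℕ) :
    (G.pairCount v : ℝ) = ∑ e ∈ G.vertices.powersetCard 2, if G.weight e = v then 1 else 0 := by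
  rw [Finset.sum_boole, pairCount]

theorem pairCount_interact (G : WeightedGraph) {t : Finset ℕ} (ht : t ⊆ G.vertices) (v : ℕ) :
    ((G.interact t).pairCount v : ℝ) - G.pairCount v
      = ∑ e ∈ t.powersetCard 2, weightShift v (G.weight e) := by
  rw [pairCount_eq_sum, pairCount_eq_sum]
  change ∑ e ∈ G.vertices.powersetCard 2, _ - _ = _
  rw [← Finset.sum_sub_distrib]
  symm
  rw [← Finset.sum_subset (Finset.powersetCard_mono ht) (f := fun e =>
    (if (G.interact t).weight e = v then (1 : ℝ) else 0) - if G.weight e = v then 1 else 0)]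
  · refine Finset.sum_congr rfl fun e he => ?_
    rw [interact_weight _ _ _ (ne_empty_of_mem_powersetCard he),
      if_pos (Finset.mem_powersetCard.1 he).1]
    rfl
  · intro e he hne
    have : ¬ e ⊆ t := fun hs => hne (Finset.mem_powersetCard.2 ⟨hs, (Finset.mem_powersetCard.1 he).2⟩)
    rw [interact_weight _ _ _ (ne_empty_of_mem_powersetCard he), if_neg this, add_zero, sub_self]

theorem HasHistory.pairCount_addVertex {n : ℕ} {G : WeightedGraph} (h : G.HasHistory n) {v : ℕ}
    (hv : 1 ≤ v) : G.addVertex.pairCount v = G.pairCount v := by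
  rw [← h.edgeCount_eq hv, ← h.addVertex.edgeCount_eq hv]
  rfl

theorem HasHistory.pairCount_addVertexInteract {n : ℕ} {G : WeightedGraph} (h : G.HasHistory n)
    {e : Finset ℕ} (he : e ∈ G.vertices.powersetCard 2) {v : ℕ} (hv : 1 ≤ v) :
    ((G.addVertexInteract e).pairCount v : ℝ) - G.pairCount v
      = weightShift v (G.weight e) + 2 * (if v = 1 then 1 else 0) := by
  have hG := G.numVertices_notMem
  obtain ⟨hes, hec⟩ := Finset.mem_powersetCard.1 he
  have hsub := (Finset.mem_powersetCard.1 (G.insert_mem_powersetCard he)).1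
  rw [← h.pairCount_addVertex hv, WeightedGraph.addVertexInteract, pairCount_interact _ hsub]
  change ∑ e ∈ _, weightShift v (G.weight e) = _
  have hNe : G.numVertices ∉ e := fun hm => hG (hes hm)
  -- The three pairs of the new triple are `e` and two pairs through the new vertex; these two pass
  -- from weight 0 to weight 1.
  rw [Finset.powersetCard_succ_insert hNe, Finset.sum_union]
  · have h1 : e.powersetCard (1 + 1) = {e} := by
      conv_lhs => rw [show 1 + 1 = e.card from hec.symm]
      exact Finset.powersetCard_self e
    rw [h1, Finset.sum_singleton]
    congr 1
    have hzero : ∀ d ∈ (e.powersetCard 1).image (insert G.numVertices),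
        weightShift v (G.weight d) = if v = 1 then 1 else 0 := by
      intro d hd
      obtain ⟨d', -, rfl⟩ := Finset.mem_image.1 hd
      rw [h.weight_eq_zero fun hs => hG (hs (Finset.mem_insert_self _ _)), weightShift,
        if_neg (show ¬ 0 = v by omega), sub_zero]
      exact if_congr (by omega) rfl rfl
    rw [Finset.sum_congr rfl hzero, Finset.sum_const, Finset.card_image_of_injOn,
      Finset.card_powersetCard, hec, nsmul_eq_mul]
    · norm_num
    · intro d hd d' hd' hdd
      have hn : ∀ x ∈ (e.powersetCard 1 : Finset (Finset ℕ)), G.numVertices ∉ x := fun x hx hm =>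
        hNe ((Finset.mem_powersetCard.1 hx).1 hm)
      rw [← Finset.erase_insert (hn d hd), ← Finset.erase_insert (hn d' hd'), hdd]
  · rw [Finset.disjoint_left]
    intro d hd hd'
    obtain ⟨d', -, rfl⟩ := Finset.mem_image.1 hd'
    exact hNe ((Finset.mem_powersetCard.1 hd).1 (Finset.mem_insert_self _ _))

theorem sum_weightShift_mul_weight (G : WeightedGraph) {v : ℕ} (hv : 1 ≤ v) :
    ∑ e ∈ G.vertices.powersetCard 2, weightShift v (G.weight e) * G.weight e
      = ((v : ℝ) - 1) * G.pairCount (v - 1) - v * G.pairCount v := by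
  rw [pairCount_eq_sum, pairCount_eq_sum, Finset.mul_sum, Finset.mul_sum, ← Finset.sum_sub_distrib]
  refine Finset.sum_congr rfl fun e _ => ?_
  obtain ⟨u, rfl⟩ := Nat.exists_eq_add_of_le' hv
  simp only [weightShift, Nat.add_right_cancel_iff, Nat.add_sub_cancel]
  split_ifs with h1 h2 h2
  · omega
  · rw [h1]; push_cast; ring
  · rw [h2]; push_cast; ring
  · ring

theorem sum_weightShift (G : WeightedGraph) {v : ℕ} (hv : 1 ≤ v) :
    ∑ e ∈ G.vertices.powersetCard 2, weightShift v (G.weight e)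
      = (G.pairCount (v - 1) : ℝ) - G.pairCount v := by
  rw [pairCount_eq_sum, pairCount_eq_sum, ← Finset.sum_sub_distrib]
  refine Finset.sum_congr rfl fun e _ => ?_
  rw [weightShift]
  congr 1
  exact if_congr (by omega) rfl rfl

end WeightedGraph

/-! ### Probabilities of the draws. -/

open WeightedGraph

theorem card_filter_superset {s e : Finset ℕ} {k : ℕ} (he : e ⊆ s) (hk : e.card = k) :
    ((s.powersetCard (k + 1)).filter fun t => e ⊆ t).card = s.card - k := by
  rw [← hk, ← Finset.card_sdiff_of_subset he, ← Finset.card_image_of_injOn (s := s \ e)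
    (f := fun a => insert a e)]
  · congr 1
    ext t
    simp only [Finset.mem_filter, Finset.mem_powersetCard, Finset.mem_image, Finset.mem_sdiff]
    constructor
    · rintro ⟨⟨hts, htc⟩, het⟩
      have h1 : (t \ e).card = 1 := by rw [Finset.card_sdiff_of_subset het]; omega
      obtain ⟨a, ha⟩ := Finset.card_eq_one.1 h1
      have hat : a ∈ t \ e := by simp [ha]
      rw [Finset.mem_sdiff] at hat
      refine ⟨a, ⟨hts hat.1, hat.2⟩, ?_⟩
      rw [← Finset.singleton_union, ← ha, Finset.sdiff_union_of_subset het]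
    · rintro ⟨a, ⟨has, hae⟩, rfl⟩
      exact ⟨⟨Finset.insert_subset has he, Finset.card_insert_of_notMem hae⟩,
        Finset.subset_insert _ _⟩
  · intro a ha b hb hab
    simp only [Finset.coe_sdiff, Set.mem_sdiff, Finset.mem_coe] at ha hb
    have hab' : insert a e = insert b e := hab
    have : a ∈ insert b e := hab' ▸ Finset.mem_insert_self a e
    exact (Finset.mem_insert.1 this).resolve_right ha.2

theorem drawProb_nonneg {α : Type*} (S : Finset α) (w : α → ℕ) (x : α) : 0 ≤ drawProb S w x := by
  unfold drawProb
  split_ifs <;> positivity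

theorem pairProb_nonneg {r : ℝ} (hr0 : 0 ≤ r) (hr1 : r ≤ 1) (G : WeightedGraph) (e : Finset ℕ) :
    0 ≤ pairProb r G e := by
  have := drawProb_nonneg G.edges G.weight e
  have := drawProb_nonneg (G.vertices.powersetCard 2) (fun _ => 1) e
  have := sub_nonneg.2 hr1
  unfold pairProb
  positivity

theorem tripleProb_nonneg {q : ℝ} (hq0 : 0 ≤ q) (hq1 : q ≤ 1) (G : WeightedGraph)
    (t : Finset ℕ) : 0 ≤ tripleProb q G t := by
  have := drawProb_nonneg G.triangles G.weight t
  have := drawProb_nonneg (G.vertices.powersetCard 3) (fun _ => 1) t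
  have := sub_nonneg.2 hq1
  unfold tripleProb
  positivity

section Prob

variable {n : ℕ} {G : WeightedGraph} (h : G.HasHistory n)
include h

/-- Non-edges have weight 0, so one formula, affine in the weight, covers all pairs. -/
theorem WeightedGraph.HasHistory.pairProb_eq (r : ℝ) {e : Finset ℕ} (he : e ∈ G.vertices.powersetCard 2) :
    pairProb r G e = r / (3 * (n + 1)) * G.weight e + (1 - r) / G.numVertices.choose 2 := by
  have h1 : drawProb G.edges G.weight e = G.weight e / (3 * ((n : ℝ) + 1)) := by
    have hs : ∑ e ∈ G.edges, (G.weight e : ℝ) = 3 * ((n : ℝ) + 1) := by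
      exact_mod_cast h.sum_edges_weight
    rw [drawProb, hs]
    split_ifs with hm
    · rfl
    · have : G.weight e = 0 := by
        by_contra h0
        exact hm ((h.mem_edges_iff he).2 h0)
      simp [this]
  have h2 : drawProb (G.vertices.powersetCard 2) (fun _ => 1) e
      = 1 / (G.numVertices.choose 2 : ℝ) := by
    rw [drawProb, if_pos he]
    simp [vertices]
  rw [pairProb, h1, h2]
  ring

theorem WeightedGraph.HasHistory.tripleProb_eq (q : ℝ) {t : Finset ℕ} (ht : t ∈ G.vertices.powersetCard 3) :
    tripleProb q G t = q / (n + 1) * G.weight t + (1 - q) / G.numVertices.choose 3 := by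
  have h1 : drawProb G.triangles G.weight t = G.weight t / ((n : ℝ) + 1) := by
    have hs : ∑ e ∈ G.triangles, (G.weight e : ℝ) = (n : ℝ) + 1 := by
      exact_mod_cast h.sum_triangles_weight
    rw [drawProb, hs]
    split_ifs with hm
    · rfl
    · simp [h.weight_eq_zero_of_notMem_triangles ht hm]
  have h2 : drawProb (G.vertices.powersetCard 3) (fun _ => 1) t
      = 1 / (G.numVertices.choose 3 : ℝ) := by
    rw [drawProb, if_pos ht]
    simp [vertices]
  rw [tripleProb, h1, h2]
  ring

theorem WeightedGraph.HasHistory.choose_pos {k : ℕ} (hk : k ≤ 3) : (0 : ℝ) < G.numVertices.choose k := by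
  exact_mod_cast Nat.choose_pos (hk.trans h.1)

theorem WeightedGraph.HasHistory.sum_pairProb (r : ℝ) : ∑ e ∈ G.vertices.powersetCard 2, pairProb r G e = 1 := by
  have hC := h.choose_pos (k := 2) (by norm_num)
  have hs : ∑ e ∈ G.vertices.powersetCard 2, (G.weight e : ℝ) = 3 * ((n : ℝ) + 1) := by
    exact_mod_cast h.sum_pairs_weight
  rw [Finset.sum_congr rfl fun e he => h.pairProb_eq r he, Finset.sum_add_distrib,
    ← Finset.mul_sum, hs, Finset.sum_const, Finset.card_powersetCard, vertices, Finset.card_range,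
    nsmul_eq_mul]
  field_simp
  ring

theorem WeightedGraph.HasHistory.sum_tripleProb (q : ℝ) :
    ∑ t ∈ G.vertices.powersetCard 3, tripleProb q G t = 1 := by
  have hC := h.choose_pos (k := 3) (by norm_num)
  have hs : ∑ e ∈ G.vertices.powersetCard 3, (G.weight e : ℝ) = (n : ℝ) + 1 := by
    exact_mod_cast h.sum_triples
  rw [Finset.sum_congr rfl fun e he => h.tripleProb_eq q he, Finset.sum_add_distrib,
    ← Finset.mul_sum, hs, Finset.sum_const, Finset.card_powersetCard, vertices, Finset.card_range,
    nsmul_eq_mul]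
  field_simp
  ring

/-- The probability that a given pair is contained in the drawn triple. -/
theorem WeightedGraph.HasHistory.sum_tripleProb_containing (q : ℝ) {e : Finset ℕ}
    (he : e ∈ G.vertices.powersetCard 2) :
    ∑ t ∈ (G.vertices.powersetCard 3).filter (fun t => e ⊆ t), tripleProb q G t
      = q / (n + 1) * G.weight e + 3 * (1 - q) / G.numVertices.choose 2 := by
  have hC := h.choose_pos (k := 3) (by norm_num)
  have hC2 := h.choose_pos (k := 2) (by norm_num)
  obtain ⟨hes, hec⟩ := Finset.mem_powersetCard.1 he
  have hs : ∑ t ∈ (G.vertices.powersetCard 3).filter (fun t => e ⊆ t), (G.weight t : ℝ)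
      = G.weight e := by
    exact_mod_cast h.sum_triples_containing (ne_empty_of_mem_powersetCard he)
  -- Exactly `N - 2` triples contain `e`; this identity turns `(N - 2) / (N choose 3)` into `3 / (N
  -- choose 2)`.
  have hch : (G.numVertices.choose 3 : ℝ) * 3
      = G.numVertices.choose 2 * (G.numVertices - 2 : ℕ) := by
    exact_mod_cast Nat.choose_succ_right_eq G.numVertices 2
  rw [Finset.sum_congr rfl fun t ht => h.tripleProb_eq q (Finset.mem_filter.1 ht).1,
    Finset.sum_add_distrib, ← Finset.mul_sum, hs, Finset.sum_const, card_filter_superset hes hec,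
    vertices, Finset.card_range, nsmul_eq_mul]
  congr 1
  field_simp
  linear_combination (-(1 - q)) * hch

end Prob

/-! ### One-step means and increments. -/

/-- The mean of `φ` after one step from `G`. -/
noncomputable def stepMean (p q r : ℝ) (G : WeightedGraph) (φ : WeightedGraph → ℝ) : ℝ :=
  p * (∑ e ∈ G.vertices.powersetCard 2, pairProb r G e * φ (G.addVertexInteract e))
    + (1 - p) * (∑ t ∈ G.vertices.powersetCard 3, tripleProb q G t * φ (G.interact t))

/-- `H` can be reached from `G` in one step. -/
def IsSuccessor (G H : WeightedGraph) : Prop :=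
  (∃ e ∈ G.vertices.powersetCard 2, G.addVertexInteract e = H) ∨
    ∃ t ∈ G.vertices.powersetCard 3, G.interact t = H

theorem stepProb_eq_zero {p q r : ℝ} {G H : WeightedGraph} (hGH : ¬ IsSuccessor G H) :
    stepProb p q r G H = 0 := by
  simp only [IsSuccessor, not_or, not_exists, not_and] at hGH
  rw [stepProb, Finset.sum_eq_zero fun e he => if_neg (hGH.1 e he),
    Finset.sum_eq_zero fun t ht => if_neg (hGH.2 t ht)]
  simp

theorem IsSuccessor.hasHistory {n : ℕ} {G H : WeightedGraph} (hGH : IsSuccessor G H)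
    (h : G.HasHistory n) : H.HasHistory (n + 1) := by
  rcases hGH with ⟨e, he, rfl⟩ | ⟨t, ht, rfl⟩
  · exact h.addVertexInteract he
  · exact h.interact ht

open Classical in
theorem hasSum_stepProb_mul (p q r : ℝ) (G : WeightedGraph) (φ : WeightedGraph → ℝ) :
    HasSum (fun H => stepProb p q r G H * φ H) (stepMean p q r G φ) := by
  have key : ∀ (S : Finset (Finset ℕ)) (f : Finset ℕ → WeightedGraph) (w : Finset ℕ → ℝ),
      HasSum (fun H => (∑ e ∈ S, if f e = H then w e else 0) * φ H) (∑ e ∈ S, w e * φ (f e)) := by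
    intro S f w
    simp only [Finset.sum_mul]
    refine hasSum_sum fun e _ => ?_
    have : w e * φ (f e) = (if f e = f e then w e else 0) * φ (f e) := by simp
    rw [this]
    refine hasSum_single (f e) fun H hH => ?_
    rw [if_neg fun h => hH h.symm, zero_mul]
  have := ((key (G.vertices.powersetCard 2) G.addVertexInteract (pairProb r G)).mul_left p).add
    ((key (G.vertices.powersetCard 3) G.interact (tripleProb q G)).mul_left (1 - p))
  have heq : (fun H => stepProb p q r G H * φ H) = _ := funext fun H => by
    rw [stepProb, add_mul, mul_assoc, mul_assoc]
  rw [heq]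
  exact this

section Mean

variable {n : ℕ} {G : WeightedGraph} (h : G.HasHistory n) {p q r : ℝ}
include h

theorem WeightedGraph.HasHistory.stepMean_sub_const (φ : WeightedGraph → ℝ) (c : ℝ) :
    stepMean p q r G (fun H => φ H - c) = stepMean p q r G φ - c := by
  simp only [stepMean, mul_sub, Finset.sum_sub_distrib, ← Finset.sum_mul,
    h.sum_pairProb, h.sum_tripleProb]
  ring

theorem WeightedGraph.HasHistory.abs_stepMean_le (hp0 : 0 ≤ p) (hp1 : p ≤ 1) (hq0 : 0 ≤ q) (hq1 : q ≤ 1)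
    (hr0 : 0 ≤ r) (hr1 : r ≤ 1) {φ : WeightedGraph → ℝ} {C : ℝ}
    (hφ : ∀ H, IsSuccessor G H → |φ H| ≤ C) : |stepMean p q r G φ| ≤ C := by
  have h1 : |∑ e ∈ G.vertices.powersetCard 2, pairProb r G e * φ (G.addVertexInteract e)| ≤ C := by
    refine (Finset.abs_sum_le_sum_abs _ _).trans ?_
    rw [← one_mul C, ← h.sum_pairProb r, Finset.sum_mul]
    refine Finset.sum_le_sum fun e he => ?_
    rw [abs_mul, abs_of_nonneg (pairProb_nonneg hr0 hr1 G e)]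
    exact mul_le_mul_of_nonneg_left (hφ _ (Or.inl ⟨e, he, rfl⟩)) (pairProb_nonneg hr0 hr1 G e)
  have h2 : |∑ t ∈ G.vertices.powersetCard 3, tripleProb q G t * φ (G.interact t)| ≤ C := by
    refine (Finset.abs_sum_le_sum_abs _ _).trans ?_
    rw [← one_mul C, ← h.sum_tripleProb q, Finset.sum_mul]
    refine Finset.sum_le_sum fun e he => ?_
    rw [abs_mul, abs_of_nonneg (tripleProb_nonneg hq0 hq1 G e)]
    exact mul_le_mul_of_nonneg_left (hφ _ (Or.inr ⟨e, he, rfl⟩)) (tripleProb_nonneg hq0 hq1 G e)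
  have hp := sub_nonneg.2 hp1
  refine (abs_add_le _ _).trans ?_
  rw [abs_mul, abs_mul, abs_of_nonneg hp0, abs_of_nonneg hp]
  nlinarith

theorem WeightedGraph.HasHistory.stepMean_numVertices :
    stepMean p q r G (fun H => (H.numVertices : ℝ) - G.numVertices) = p := by
  have h1 : ∀ e, ((G.addVertexInteract e).numVertices : ℝ) - G.numVertices = 1 := fun e => by
    change ((G.numVertices + 1 : ℕ) : ℝ) - _ = 1
    push_cast
    ring
  have h2 : ∀ t, ((G.interact t).numVertices : ℝ) - G.numVertices = 0 := fun t => sub_self _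
  simp only [stepMean, h1, h2, mul_one, mul_zero, h.sum_pairProb,
    Finset.sum_const_zero, add_zero]

/-- By linearity, each pair contributes its `weightShift` times its probability of interacting. That
probability is affine in the weight, so two sums suffice: `sum_weightShift_mul_weight` for the
weighted draws and `sum_weightShift` for the uniform ones. -/
theorem WeightedGraph.HasHistory.stepMean_pairCount {v : ℕ} (hv : 1 ≤ v) :
    stepMean p q r G (fun H => (H.pairCount v : ℝ) - G.pairCount v)
      = 2 * p * (if v = 1 then 1 else 0)
        + paramA p q r * (((v : ℝ) - 1) * G.pairCount (v - 1) - v * G.pairCount v) / (n + 1)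
        + (p * (1 - r) + 3 * (1 - p) * (1 - q)) / G.numVertices.choose 2
          * (G.pairCount (v - 1) - G.pairCount v) := by
  set F : Finset ℕ → ℝ := fun e => weightShift v (G.weight e) with hF
  have hA := G.sum_weightShift_mul_weight hv
  have hB := G.sum_weightShift hv
  have h1 : ∑ e ∈ G.vertices.powersetCard 2,
        pairProb r G e * (((G.addVertexInteract e).pairCount v : ℝ) - G.pairCount v)
      = 2 * (if v = 1 then 1 else 0)
        + ∑ e ∈ G.vertices.powersetCard 2, F e * pairProb r G e := by
    rw [Finset.sum_congr rfl fun e he => by rw [h.pairCount_addVertexInteract he hv, mul_add],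
      Finset.sum_add_distrib, ← Finset.sum_mul, h.sum_pairProb, one_mul, add_comm]
    simp only [hF, mul_comm]
  have h2 : ∑ t ∈ G.vertices.powersetCard 3,
        tripleProb q G t * (((G.interact t).pairCount v : ℝ) - G.pairCount v)
      = ∑ e ∈ G.vertices.powersetCard 2, F e *
          ∑ t ∈ (G.vertices.powersetCard 3).filter (fun t => e ⊆ t), tripleProb q G t := by
    rw [Finset.sum_congr rfl fun t ht => by
      rw [pairCount_interact G (Finset.mem_powersetCard.1 ht).1, Finset.mul_sum]]
    simp only [Finset.mul_sum]
    rw [Finset.sum_comm' (t' := G.vertices.powersetCard 2)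
      (s' := fun e => (G.vertices.powersetCard 3).filter (fun t => e ⊆ t))]
    · simp only [hF, mul_comm]
    · intro t e
      simp only [Finset.mem_powersetCard, Finset.mem_filter]
      exact ⟨fun ⟨⟨a, b⟩, c, d⟩ => ⟨⟨⟨a, b⟩, c⟩, c.trans a, d⟩,
        fun ⟨⟨⟨a, b⟩, c⟩, _, d⟩ => ⟨⟨a, b⟩, c, d⟩⟩
  have hlin : ∀ x y : ℝ, ∑ e ∈ G.vertices.powersetCard 2, F e * (x * G.weight e + y)
      = x * (((v : ℝ) - 1) * G.pairCount (v - 1) - v * G.pairCount v)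
        + y * (G.pairCount (v - 1) - G.pairCount v) := by
    intro x y
    rw [← hA, ← hB, Finset.mul_sum, Finset.mul_sum, ← Finset.sum_add_distrib]
    exact Finset.sum_congr rfl fun e _ => by simp only [hF]; ring
  rw [stepMean, h1, h2,
    Finset.sum_congr rfl fun e he => by rw [h.pairProb_eq r he], hlin,
    Finset.sum_congr rfl fun e he => by rw [h.sum_tripleProb_containing q he], hlin,
    paramA]
  have hC2 := h.choose_pos (k := 2) (by norm_num)
  field_simp
  ring

theorem WeightedGraph.HasHistory.abs_pairCount_sub_le {H : WeightedGraph} (hGH : IsSuccessor G H) {v : ℕ}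
    (hv : 1 ≤ v) : |(H.pairCount v : ℝ) - G.pairCount v| ≤ 3 := by
  rcases hGH with ⟨e, he, rfl⟩ | ⟨t, ht, rfl⟩
  · rw [h.pairCount_addVertexInteract he hv]
    refine (abs_add_le _ _).trans ?_
    have h1 := abs_weightShift_le v (G.weight e)
    have h2 : |(2 : ℝ) * (if v = 1 then 1 else 0)| ≤ 2 := by split_ifs <;> simp
    linarith
  · obtain ⟨hs, hc⟩ := Finset.mem_powersetCard.1 ht
    rw [pairCount_interact G hs]
    refine (Finset.abs_sum_le_sum_abs _ _).trans
      ((Finset.sum_le_sum fun e _ => abs_weightShift_le _ _).trans ?_)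
    rw [Finset.sum_const, Finset.card_powersetCard, hc, nsmul_eq_mul, mul_one]
    norm_num [Nat.choose]

end Mean

theorem abs_numVertices_sub_le {G H : WeightedGraph} (hGH : IsSuccessor G H) :
    |(H.numVertices : ℝ) - G.numVertices| ≤ 3 := by
  rcases hGH with ⟨e, he, rfl⟩ | ⟨t, ht, rfl⟩
  · change |((G.numVertices + 1 : ℕ) : ℝ) - _| ≤ 3
    push_cast
    rw [add_sub_cancel_left]
    norm_num
  · change |(G.numVertices : ℝ) - _| ≤ 3
    simp

/-! ### Path events and martingale differences. -/

instance : DiscreteMeasurableSpace WeightedGraph := ⟨fun _ => trivial⟩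

/-- Countability makes the finite paths a countable partition, so that conditioning on the past
reduces to sums over atoms. -/
instance : Countable WeightedGraph :=
  Function.Injective.countable
    (f := fun G : WeightedGraph => (G.numVertices, G.edges, G.weight)) fun G H hGH => by
      simp only [Prod.mk.injEq] at hGH
      exact WeightedGraph.ext hGH.1 hGH.2.1 hGH.2.2

/-- The deviation of `Y` from its mean in a step from `G` to `H`. -/
noncomputable def innovation (p q r : ℝ) (Y : WeightedGraph → ℝ) (G H : WeightedGraph) : ℝ :=
  Y H - Y G - stepMean p q r G (fun K => Y K - Y G)

namespace IsThreeInteractionsProcess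

section Path

variable {Ω : Type*} {X : ℕ → Ω → WeightedGraph}

/-- The event that the evolution up to step `n` is `x`. -/
def pathEvent (X : ℕ → Ω → WeightedGraph) (n : ℕ) (x : Fin (n + 1) → WeightedGraph) : Set Ω :=
  {ω | ∀ i : Fin (n + 1), X i ω = x i}

theorem pathEvent_disjoint (n : ℕ) :
    Pairwise (Function.onFun Disjoint (pathEvent X n)) := fun x y hxy => by
  refine Set.disjoint_left.2 fun ω hω hω' => hxy (funext fun i => ?_)
  rw [← hω i, hω' i]

theorem iUnion_pathEvent (n : ℕ) : ⋃ x, pathEvent X n x = Set.univ :=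
  Set.eq_univ_of_forall fun ω => Set.mem_iUnion.2 ⟨fun i => X i ω, fun _ => rfl⟩

end Path

variable {Ω : Type*} [MeasurableSpace Ω] {μ : Measure Ω}
  {p q r : ℝ} {X : ℕ → Ω → WeightedGraph} (hX : IsThreeInteractionsProcess μ p q r X)

include hX

theorem measurableSet_pathEvent (n : ℕ) (x : Fin (n + 1) → WeightedGraph) :
    MeasurableSet (pathEvent X n x) := by
  simp only [pathEvent, Set.ofPred_forall]
  exact MeasurableSet.iInter fun i => hX.measurable i (MeasurableSet.of_discrete (s := {x i}))

theorem measureReal_pathEvent_inter (n : ℕ) (x : Fin (n + 1) → WeightedGraph)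
    (H : WeightedGraph) :
    μ.real (pathEvent X n x ∩ {ω | X (n + 1) ω = H})
      = μ.real (pathEvent X n x) * stepProb p q r (x (Fin.last n)) H := by
  -- `Fin.ofNat` extends the finite path to a sequence on `ℕ`; its values beyond `n` play no role.
  have hpath : pathEvent X n x = {ω | ∀ i ≤ n, X i ω = x (Fin.ofNat (n + 1) i)} := by
    ext ω
    simp only [pathEvent, Set.mem_ofPred_eq]
    constructor
    · intro h i hi
      have := h (Fin.ofNat (n + 1) i)
      rwa [Fin.val_ofNat, Nat.mod_eq_of_lt (Nat.lt_succ_of_le hi)] at this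
    · intro h i
      rw [h i (Nat.le_of_lt_succ i.2)]
      congr 1
      ext
      simp
  have hlast : x (Fin.last n) = x (Fin.ofNat (n + 1) n) := by
    congr 1
    ext
    simp
  rw [hpath, hlast]
  exact hX.step n (fun i => x (Fin.ofNat (n + 1) i)) H

theorem setIntegral_pathEvent (n : ℕ) (x : Fin (n + 1) → WeightedGraph) {φ : WeightedGraph → ℝ}
    (hint : IntegrableOn (fun ω => φ (X (n + 1) ω)) (pathEvent X n x) μ) :
    ∫ ω in pathEvent X n x, φ (X (n + 1) ω) ∂μ
      = μ.real (pathEvent X n x) * stepMean p q r (x (Fin.last n)) φ := by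
  have hm := hX.measurable (n + 1)
  have hφ : Measurable φ := Measurable.of_discrete
  rw [← integral_map (f := φ) hm.aemeasurable hφ.aestronglyMeasurable, integral_countable]
  · rw [← (hasSum_stepProb_mul p q r (x (Fin.last n)) φ).tsum_eq, ← tsum_mul_left]
    refine tsum_congr fun H => ?_
    rw [map_measureReal_apply hm MeasurableSet.of_discrete,
      measureReal_restrict_apply (hm MeasurableSet.of_discrete), smul_eq_mul, ← mul_assoc,
      ← hX.measureReal_pathEvent_inter n x H, Set.inter_comm]
    rfl
  · exact (integrable_map_measure hφ.aestronglyMeasurable hm.aemeasurable).2 hint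

variable [IsProbabilityMeasure μ]

theorem ae_isSuccessor (n : ℕ) : ∀ᵐ ω ∂μ, IsSuccessor (X n ω) (X (n + 1) ω) := by
  have key : ∀ (x : Fin (n + 1) → WeightedGraph) (H : WeightedGraph),
      ∀ᵐ ω ∂μ, ω ∈ pathEvent X n x → X (n + 1) ω = H → IsSuccessor (x (Fin.last n)) H := by
    intro x H
    by_cases hs : IsSuccessor (x (Fin.last n)) H
    · exact Eventually.of_forall fun _ _ _ => hs
    · have h0 := hX.measureReal_pathEvent_inter n x H
      rw [stepProb_eq_zero hs, mul_zero, measureReal_eq_zero_iff] at h0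
      filter_upwards [measure_eq_zero_iff_ae_notMem.1 h0] with ω hω h1 h2
      exact absurd ⟨h1, h2⟩ hω
  filter_upwards [ae_all_iff.2 fun x => ae_all_iff.2 (key x)] with ω hω
  exact hω (fun i => X i ω) _ (fun _ => rfl) rfl

theorem ae_hasHistory (n : ℕ) : ∀ᵐ ω ∂μ, (X n ω).HasHistory n := by
  induction n with
  | zero =>
    filter_upwards [hX.initial] with ω hω
    rw [hω]
    exact hasHistory_initial
  | succ n ih =>
    filter_upwards [ih, hX.ae_isSuccessor n] with ω h1 h2
    exact h2.hasHistory h1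

/-- A martingale difference is orthogonal to every function of the past. -/
theorem integral_past_mul_eq_zero (n : ℕ) (F : (Fin (n + 1) → WeightedGraph) → ℝ)
    (ψ : WeightedGraph → WeightedGraph → ℝ)
    (hψ : ∀ G, G.HasHistory n → stepMean p q r G (ψ G) = 0)
    (hψi : Integrable (fun ω => ψ (X n ω) (X (n + 1) ω)) μ)
    (hint : Integrable (fun ω => F (fun i => X i ω) * ψ (X n ω) (X (n + 1) ω)) μ) :
    ∫ ω, F (fun i => X i ω) * ψ (X n ω) (X (n + 1) ω) ∂μ = 0 := by
  rw [← setIntegral_univ, ← iUnion_pathEvent (X := X) n,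
    integral_iUnion (hX.measurableSet_pathEvent n) (pathEvent_disjoint n) hint.integrableOn]
  refine (tsum_congr fun x => ?_).trans tsum_zero
  have hlast : ∀ ω ∈ pathEvent X n x, X n ω = x (Fin.last n) := fun ω hω => hω (Fin.last n)
  -- The mean of `ψ` is known to vanish only at graphs with a history; paths ending elsewhere are
  -- null events.
  by_cases hx : (x (Fin.last n)).HasHistory n
  · have h1 : Set.EqOn (fun ω => F (fun i => X i ω) * ψ (X n ω) (X (n + 1) ω))
        (fun ω => F x * ψ (x (Fin.last n)) (X (n + 1) ω)) (pathEvent X n x) := fun ω hω => by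
      have : (fun i : Fin (n + 1) => X i ω) = x := funext hω
      simp only [this, hlast ω hω]
    have h2 : Set.EqOn (fun ω => ψ (X n ω) (X (n + 1) ω))
        (fun ω => ψ (x (Fin.last n)) (X (n + 1) ω)) (pathEvent X n x) := fun ω hω => by
      simp only [hlast ω hω]
    have hm := hX.measurableSet_pathEvent n x
    rw [setIntegral_congr_fun hm h1, integral_const_mul,
      hX.setIntegral_pathEvent n x (hψi.integrableOn.congr_fun h2 hm), hψ _ hx, mul_zero, mul_zero]
  · have hsub : pathEvent X n x ⊆ {ω | ¬ (X n ω).HasHistory n} := fun ω hω hh =>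
      hx (hlast ω hω ▸ hh)
    exact setIntegral_measure_zero _ (measure_mono_null hsub (ae_iff.1 (hX.ae_hasHistory n)))

/-- The strong law of large numbers for the sums of the innovations of `Y`. -/
theorem ae_tendsto_sum_innovation (hp0 : 0 ≤ p) (hp1 : p ≤ 1) (hq0 : 0 ≤ q) (hq1 : q ≤ 1)
    (hr0 : 0 ≤ r) (hr1 : r ≤ 1) {Y : WeightedGraph → ℝ} {C : ℝ}
    (hY : ∀ n G H, G.HasHistory n → IsSuccessor G H → |Y H - Y G| ≤ C) :
    ∀ᵐ ω ∂μ, Tendsto (fun n : ℕ =>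
      (∑ k ∈ Finset.range n, innovation p q r Y (X k ω) (X (k + 1) ω)) / n) atTop (𝓝 0) := by
  have hmeas : ∀ n, Measurable fun ω => innovation p q r Y (X n ω) (X (n + 1) ω) := fun n =>
    (Measurable.of_discrete (f := fun z : WeightedGraph × WeightedGraph =>
      innovation p q r Y z.1 z.2)).comp ((hX.measurable n).prodMk (hX.measurable (n + 1)))
  have hbound : ∀ n, ∀ᵐ ω ∂μ, |innovation p q r Y (X n ω) (X (n + 1) ω)| ≤ C + C := by
    intro n
    filter_upwards [hX.ae_hasHistory n, hX.ae_isSuccessor n] with ω h1 h2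
    exact (abs_sub _ _).trans (add_le_add (hY n _ _ h1 h2)
      (h1.abs_stepMean_le hp0 hp1 hq0 hq1 hr0 hr1 fun K hK => hY n _ _ h1 hK))
  refine ae_tendsto_sum_div_of_orthogonal hmeas hbound fun i j hij => ?_
  -- As `i + 1 ≤ j`, the `i`-th innovation is a function of the path up to time `j`.
  exact hX.integral_past_mul_eq_zero j (fun x => innovation p q r Y
      (x ⟨i, by omega⟩) (x ⟨i + 1, by omega⟩)) (innovation p q r Y)
    (fun G hG => by
      change stepMean p q r G (fun H => Y H - Y G - stepMean p q r G (fun K => Y K - Y G)) = 0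
      rw [hG.stepMean_sub_const, sub_self])
    (Integrable.of_bound (hmeas j).aestronglyMeasurable (C + C) (hbound j))
    (integrable_mul_of_ae_bound (hmeas i) (hmeas j) (hbound i) (hbound j))

end IsThreeInteractionsProcess

/-! ### Limits along a single trajectory. -/

/-- The limit of the number of edges of weight `v` divided by `n * p`. -/
noncomputable def edgeLimit (p q r : ℝ) : ℕ → ℝ
  | 0 => 0
  | 1 => (p * (3 - r) + 3 * (1 - p) * (1 - q)) / ((paramA p q r + 1) * p)
  | v + 2 => ((v : ℝ) + 1) * paramA p q r / (((v : ℝ) + 2) * paramA p q r + 1)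
      * edgeLimit p q r (v + 1)

theorem edgeLimit_pos {p q r : ℝ} (hp0 : 0 < p) (hp1 : p ≤ 1) (hq1 : q ≤ 1) (hr1 : r ≤ 1)
    (ha : 0 < paramA p q r) (v : ℕ) : 0 < edgeLimit p q r (v + 1) := by
  induction v with
  | zero =>
    have h1 : 0 < p * (3 - r) := mul_pos hp0 (by linarith)
    have h2 : 0 ≤ 3 * (1 - p) * (1 - q) :=
      mul_nonneg (mul_nonneg (by norm_num) (sub_nonneg.2 hp1)) (sub_nonneg.2 hq1)
    rw [edgeLimit]
    positivity
  | succ v ih =>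
    rw [edgeLimit]
    positivity

theorem tendsto_div_succ {x : ℕ → ℝ} {L : ℝ} (h : Tendsto (fun n : ℕ => x n / n) atTop (𝓝 L)) :
    Tendsto (fun n : ℕ => x n / ((n : ℝ) + 1)) atTop (𝓝 L) := by
  have := h.mul (tendsto_natCast_div_add_atTop (1 : ℝ))
  rw [mul_one] at this
  refine this.congr' ?_
  filter_upwards [eventually_gt_atTop 0] with n hn
  have h1 : (n : ℝ) ≠ 0 := by positivity
  have h2 : (n : ℝ) + 1 ≠ 0 := by positivity
  field_simp

/-- Linearly many edges are negligible among the pairs of linearly many vertices. -/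
theorem tendsto_linear_div_choose_two {N : ℕ → ℕ} {p : ℝ} (hp : 0 < p)
    (hN : Tendsto (fun n : ℕ => (N n : ℝ) / n) atTop (𝓝 p)) :
    Tendsto (fun n : ℕ => 3 * ((n : ℝ) + 1) / (N n).choose 2) atTop (𝓝 0) := by
  have h0 := tendsto_inv_atTop_nhds_zero_nat (𝕜 := ℝ)
  have hnum : Tendsto (fun n : ℕ => 6 * ((n : ℝ)⁻¹ + (n : ℝ)⁻¹ * (n : ℝ)⁻¹)) atTop (𝓝 0) := by
    simpa using (h0.add (h0.mul h0)).const_mul 6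
  have hden : Tendsto (fun n : ℕ => (N n : ℝ) / n * ((N n : ℝ) / n - (n : ℝ)⁻¹)) atTop
      (𝓝 (p * p)) := by
    simpa using hN.mul (hN.sub h0)
  have := hnum.div hden (by positivity)
  rw [zero_div] at this
  refine this.congr' ?_
  filter_upwards [eventually_gt_atTop 0] with n hn
  have h1 : (n : ℝ) ≠ 0 := by positivity
  rw [Pi.div_apply, Nat.cast_choose_two]
  -- If `N n ≤ 1`, both quotients are `0` by division by zero.
  rcases eq_or_ne ((N n : ℝ) * (N n - 1)) 0 with hz | hz
  · rw [hz]
    have : (N n : ℝ) / n * ((N n : ℝ) / n - (n : ℝ)⁻¹) = (N n : ℝ) * (N n - 1) / n ^ 2 := by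
      field_simp
    rw [this, hz]
    simp
  · have hz1 := left_ne_zero_of_mul hz
    have hz2 := right_ne_zero_of_mul hz
    have h3 : (N n : ℝ) / n - (n : ℝ)⁻¹ = (N n - 1) / n := by field_simp
    rw [h3]
    field_simp
    norm_num

section Trajectory

variable {p q r : ℝ} {x : ℕ → WeightedGraph} (hist : ∀ n, (x n).HasHistory n)

include hist

/-- The undamped case `c = 0`: the drift is constantly `p`. -/
theorem tendsto_numVertices_div
    (hV : Tendsto (fun n : ℕ => (∑ k ∈ Finset.range n,
      innovation p q r (fun G => (G.numVertices : ℝ)) (x k) (x (k + 1))) / n) atTop (𝓝 0)) :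
    Tendsto (fun n : ℕ => ((x n).numVertices : ℝ) / n) atTop (𝓝 p) := by
  refine tendsto_div_of_linear_recursion (b := fun _ => p) le_rfl (by simp) hV fun n => ?_
  rw [innovation, (hist n).stepMean_numVertices]
  ring

theorem tendsto_pairCount_div_choose
    (hN : Tendsto (fun n : ℕ => 3 * ((n : ℝ) + 1) / (x n).numVertices.choose 2) atTop (𝓝 0))
    (u : ℕ) : Tendsto (fun n : ℕ => ((x n).pairCount u : ℝ) / (x n).numVertices.choose 2) atTop
      (𝓝 (if u = 0 then 1 else 0)) := by
  have hC : ∀ n, (0 : ℝ) < (x n).numVertices.choose 2 := fun n =>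
    (hist n).choose_pos (by norm_num)
  split_ifs with hu
  · subst hu
    refine tendsto_of_tendsto_of_tendsto_of_le_of_le (by simpa using hN.const_sub 1)
      tendsto_const_nhds (fun n => ?_) fun n => ?_
    · have : ((x n).numVertices.choose 2 : ℝ) ≤ (x n).pairCount 0 + 3 * ((n : ℝ) + 1) := by
        exact_mod_cast (hist n).pairCount_zero.2
      have hn := hC n
      simp only
      rw [sub_le_iff_le_add, ← add_div, one_le_div hn]
      exact this
    · exact (div_le_one (hC n)).2 (by exact_mod_cast (hist n).pairCount_zero.1)
  · refine squeeze_zero (fun n => by positivity) (fun n => ?_) hN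
    have : ((x n).pairCount u : ℝ) ≤ 3 * ((n : ℝ) + 1) := by
      exact_mod_cast (hist n).pairCount_le (Nat.one_le_iff_ne_zero.2 hu)
    exact div_le_div_of_nonneg_right this (hC n).le

theorem tendsto_pairCount_div (hp0 : 0 < p) (ha : 0 < paramA p q r)
    (hN : Tendsto (fun n : ℕ => 3 * ((n : ℝ) + 1) / (x n).numVertices.choose 2) atTop (𝓝 0))
    (hM : ∀ v, Tendsto (fun n : ℕ => (∑ k ∈ Finset.range n,
      innovation p q r (fun G => (G.pairCount (v + 1) : ℝ)) (x k) (x (k + 1))) / n) atTop (𝓝 0))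
    (v : ℕ) :
    Tendsto (fun n : ℕ => ((x n).pairCount (v + 1) : ℝ) / n) atTop
      (𝓝 (p * edgeLimit p q r (v + 1))) := by
  set a := paramA p q r with hadef
  set γ := p * (1 - r) + 3 * (1 - p) * (1 - q) with hγ
  have hrec : ∀ v n : ℕ, ((x (n + 1)).pairCount (v + 1) : ℝ) - (x n).pairCount (v + 1)
      = (2 * p * (if v = 0 then 1 else 0)
          + a * (v * ((x n).pairCount v / ((n : ℝ) + 1)))
          + γ * ((x n).pairCount v / (x n).numVertices.choose 2
            - (x n).pairCount (v + 1) / (x n).numVertices.choose 2))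
        - ((v + 1) * a) * (x n).pairCount (v + 1) / (n + 1)
        + innovation p q r (fun G => (G.pairCount (v + 1) : ℝ)) (x n) (x (n + 1)) := by
    intro v n
    rw [innovation, (hist n).stepMean_pairCount (Nat.le_add_left 1 v)]
    simp only [Nat.add_sub_cancel, Nat.add_eq_right]
    push_cast
    ring
  have hratio := tendsto_pairCount_div_choose hist hN
  induction v with
  | zero =>
    refine tendsto_div_of_linear_recursion (by positivity) ?_ (hM 0) (hrec 0)
    have h1 := (((hratio 0).sub (hratio 1)).const_mul γ).const_add (2 * p)
    -- The fixed-point equation `L (1 + a) = 2p + γ`, where `2p + γ = p(3-r) + 3(1-p)(1-q)`: two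
    -- edges come with each new vertex, and `γ` from uniform draws, which almost always hit
    -- non-edges.
    have h2 : p * edgeLimit p q r (0 + 1) * (1 + (((0 : ℕ) : ℝ) + 1) * a)
        = 2 * p + γ * ((if (0 : ℕ) = 0 then 1 else 0) - if (1 : ℕ) = 0 then 1 else 0) := by
      rw [edgeLimit, ← hadef, hγ]
      push_cast
      field_simp
      norm_num
      ring
    rw [h2]
    simpa using h1
  | succ v ih =>
    refine tendsto_div_of_linear_recursion (by positivity) ?_ (hM (v + 1)) (hrec (v + 1))
    have h1 := (((tendsto_div_succ ih).const_mul (((v + 1 : ℕ) : ℝ))).const_mul a).add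
      (((hratio (v + 1)).sub (hratio (v + 1 + 1))).const_mul γ)
    -- For weights above 1 the uniform draws contribute nothing in the limit; the only inflow is
    -- from the previous weight.
    have h2 : p * edgeLimit p q r (v + 1 + 1) * (1 + (((v + 1 : ℕ) : ℝ) + 1) * a)
        = a * (((v + 1 : ℕ) : ℝ) * (p * edgeLimit p q r (v + 1)))
          + γ * ((if v + 1 = 0 then 1 else 0) - if v + 1 + 1 = 0 then 1 else 0) := by
      have h3 : ((v : ℝ) + 2) * a + 1 ≠ 0 := by positivity
      rw [edgeLimit, ← hadef, if_neg (by omega), if_neg (by omega)]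
      push_cast
      field_simp
      ring
    rw [h2]
    simpa using h1

end Trajectory

end ThreeInteractions

theorem mainTheorem3 {Ω : Type*} [MeasurableSpace Ω] (μ : Measure Ω) [IsProbabilityMeasure μ]
    (p q r : ℝ) (hp0 : 0 < p) (hp1 : p ≤ 1) (hq0 : 0 ≤ q) (hq1 : q ≤ 1) (hr0 : 0 ≤ r) (hr1 : r ≤ 1)
    (h : 0 < r ∨ 0 < (1 - p) * q)
    (X : ℕ → Ω → ThreeInteractions.WeightedGraph)
    (hX : ThreeInteractions.IsThreeInteractionsProcess μ p q r X) :
    ∃ e : ℕ → ℝ,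
      (∀ v : ℕ, 1 ≤ v → 0 < e v) ∧
      e 1 = (p * (3 - r) + 3 * (1 - p) * (1 - q)) / ((ThreeInteractions.paramA p q r + 1) * p) ∧
      (∀ v : ℕ, 1 < v →
        e v = ((v : ℝ) - 1) * ThreeInteractions.paramA p q r
          / ((v : ℝ) * ThreeInteractions.paramA p q r + 1) * e (v - 1)) ∧
      ∀ v : ℕ, 1 ≤ v → ∀ᵐ ω ∂μ,
        Tendsto (fun n : ℕ => ((X n ω).edgeCount v : ℝ) / ((n : ℝ) * p)) atTop (𝓝 (e v)) := by
  -- If `a` were `0`, the recursion would give `e_v = 0` for all `v > 1`.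
  have ha : 0 < ThreeInteractions.paramA p q r := by
    have h1 : 0 ≤ 1 / 3 * p * r := by positivity
    have h2 : 0 ≤ (1 - p) * q := mul_nonneg (sub_nonneg.2 hp1) hq0
    rw [ThreeInteractions.paramA]
    rcases h with h | h
    · have : 0 < 1 / 3 * p * r := by positivity
      linarith
    · linarith
  refine ⟨ThreeInteractions.edgeLimit p q r, ?_, ?_, ?_, ?_⟩
  · intro v hv
    obtain ⟨u, rfl⟩ := Nat.exists_eq_add_of_le' hv
    exact ThreeInteractions.edgeLimit_pos hp0 hp1 hq1 hr1 ha u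
  · rw [ThreeInteractions.edgeLimit]
  · intro v hv
    obtain ⟨u, rfl⟩ := Nat.exists_eq_add_of_le' (Nat.succ_le_of_lt hv)
    simp only [Nat.succ_eq_add_one, Nat.reduceAdd, Nat.add_one_sub_one]
    rw [ThreeInteractions.edgeLimit]
    push_cast
    ring_nf
  · intro v hv
    obtain ⟨u, rfl⟩ := Nat.exists_eq_add_of_le' hv
    -- One null set serves all weights, since the induction on `v` uses the noise of every smaller
    -- weight.
    have hM := ae_all_iff.2 fun v : ℕ => hX.ae_tendsto_sum_innovation hp0.le hp1 hq0 hq1 hr0 hr1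
      (Y := fun G => (G.pairCount (v + 1) : ℝ)) (C := 3)
      fun _ _ _ hG hGH => hG.abs_pairCount_sub_le hGH (Nat.le_add_left 1 v)
    have hV := hX.ae_tendsto_sum_innovation hp0.le hp1 hq0 hq1 hr0 hr1
      (Y := fun G => (G.numVertices : ℝ)) (C := 3)
      fun _ _ _ _ hGH => ThreeInteractions.abs_numVertices_sub_le hGH
    filter_upwards [ae_all_iff.2 hX.ae_hasHistory, hM, hV] with ω hist hM hV
    have hN := ThreeInteractions.tendsto_linear_div_choose_two hp0
      (ThreeInteractions.tendsto_numVertices_div hist hV)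
    have := (ThreeInteractions.tendsto_pairCount_div hist hp0 ha hN hM u).div_const p
    rw [mul_div_cancel_left₀ _ hp0.ne'] at this
    refine this.congr fun n => ?_
    rw [(hist n).edgeCount_eq hv, div_div]
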